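/- **Setting.** Let $\Omega\subset\mathbb{R}^N$ be a bounded open set, $T>0$, $0<c<1$, $0<\varepsilon\le\eta$, $\Omega_T=\Omega\times(0,T]$, and for $r>0$ let $$\Gamma_r=\{x:\operatorname{dist}(x,\Omega)\le r\}\times(-r^2,0]\ \cup\ \{x\notin\Omega:\operatorname{dist}(x,\partial\Omega)\le r\}\times(0,T].$$ Let $F:\Gamma_\eta\to\mathbb{R}$ be a bounded Borel function. For each $(x,t)\in\Omega_T$ let $\mathcal{A}(x,t)$ be a compact subset of $B(0,1)\times[-\frac c2,\frac c2]$ containing $(0,0)$ (no further regularity in $(x,t)$ is assumed), and put $$\mathcal{A}_\varepsilon(x,t)=\Big\{(x,t)+\Big(\varepsilon y,\ \varepsilon^2\tfrac{1-c}{c}s-\varepsilon^2\tfrac{c+1}{2}\Big):(y,s)\in\mathcal{A}(x,t)\Big\}\subset\Omega_T\cup\Gamma_\varepsilon .$$ **Game.** A token starts at $z_0$. In each round a fair coin is tossed (independently of the past) and the winner moves the token from $z_k\in\Omega_T$ to a point $z_{k+1}\in\mathcal{A}_\varepsilon(z_k)$ of his choice. The game stops at the first time $\tau$ at which $z_\tau\in\Gamma_\varepsilon$,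 and Player II then pays $F(z_\tau)$ to Player I. For each $k\ge 0$ let $\mathcal{M}_k$ be a $\sigma$-algebra on the space of histories $(z_0,\dots,z_k)$ which contains the Borel sets, and write $\mathcal{M}=(\mathcal{M}_k)_{k\ge0}$. An $\mathcal{M}$-strategy is a sequence of maps, the $k$-th of which is measurable from $\mathcal{M}_k$ to the Borel $\sigma$-algebra and sends each history $(z_0,\dots,z_k)$ with $z_k\in\Omega_T$ to a point of $\mathcal{A}_\varepsilon(z_k)$. With $\mathcal{M}$-strategies for both players, put $$u_I^\varepsilon(z)=\sup_{S_I}\inf_{S_{II}}\mathbb{E}^{z}_{S_I,S_{II}}[F(z_\tau)],\qquad u_{II}^\varepsilon(z)=\inf_{S_{II}}\sup_{S_I}\mathbb{E}^{z}_{S_I,S_{II}}[F(z_\tau)]\qquad(z\in\Omega_T\cup\Gamma_\varepsilon).$$ **Dynamic programming principle (DPP).** A real function $v$ on $\Omega_T\cup\Gamma_\varepsilon$ that is bounded on each $\mathcal{A}_\varepsilon(x,t)$, $(x,t)\in\Omega_T$, is a *subsolution* (respectively *supersolution*) of the DPP if for every $(x,t)\in\Omega_T$ $$v(x,t)\le\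 (\text{respectively}\ \ge)\ \ \tfrac12\sup_{\mathcal{A}_\varepsilon(x,t)}v+\tfrac12\inf_{\mathcal{A}_\varepsilon(x,t)}v .$$ It is a *DPP function with boundary data $F$* if equality holds for every $(x,t)\in\Omega_T$ and $v=F$ on $\Gamma_\varepsilon$. **Theorem (comparison).** For every choice of $\mathcal{M}$ as above (in particular for Borel measurable strategies): 1. If $v$ is a subsolution of the DPP with $v\le F$ on $\Gamma_\varepsilon$, then $u_{II}^\varepsilon\ge v$ in $\Omega_T$. 2. If $v$ is a supersolution of the DPP with $v\ge F$ on $\Gamma_\varepsilon$, then $u_{I}^\varepsilon\le v$ in $\Omega_T$. 3. Every DPP function $v$ with boundary data $F$ satisfies $u_I^\varepsilon\le v\le u_{II}^\varepsilon$ on $\Omega_T\cup\Gamma_\varepsilon$. Moreover, if each $\mathcal{M}_k$ is the $\sigma$-algebra of all subsets (no measurability restriction on strategies), then $u_I^\varepsilon$ and $u_{II}^\varepsilon$ are themselves DPP functions with boundary data $F$; hence $u_I^\varepsilon$ is then the lowest, and $u_{II}^\varepsilon$ the largest, DPP function with boundary data $F$. -/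

import Mathlib

open Set MeasureTheory

namespace TugOfWar

/-- Space-time points `(x, t)`, with `x` in Euclidean `N`-space. -/
abbrev Point (N : ℕ) : Type := EuclideanSpace ℝ (Fin N) × ℝ

/-- The parabolic cylinder `Ω × (0, T]`. -/
def cylinder {N : ℕ} (Ω : Set (EuclideanSpace ℝ (Fin N))) (T : ℝ) : Set (Point N) :=
  Ω ×ˢ Ioc 0 T

/-- The parabolic boundary strip of width `r`:
`{dist(x, Ω) ≤ r} × (-r², 0] ∪ {x ∉ Ω, dist(x, ∂Ω) ≤ r} × (0, T]`. -/
def strip {N : ℕ} (Ω : Set (EuclideanSpace ℝ (Fin N))) (T r : ℝ) : Set (Point N) :=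
  Metric.cthickening r Ω ×ˢ Ioc (-r ^ 2) 0 ∪
    (Ωᶜ ∩ Metric.cthickening r (frontier Ω)) ×ˢ Ioc 0 T

/-- Condition on a shape set `K`: compact, contained in `B(0,1) × [-c/2, c/2]`, and containing
the origin. -/
def IsShape {N : ℕ} (c : ℝ) (K : Set (Point N)) : Prop :=
  IsCompact K ∧ K ⊆ Metric.ball 0 1 ×ˢ Icc (-(c / 2)) (c / 2) ∧ (0, 0) ∈ K

/-- The possible moves from `z = (x, t)`: the points
`(x, t) + (ε y, ε² ((1 - c) / c) s - ε² (c + 1) / 2)` with `(y, s) ∈ A (x, t)`. -/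
def moves {N : ℕ} (c ε : ℝ) (A : Point N → Set (Point N)) (z : Point N) : Set (Point N) :=
  (fun p : Point N =>
    z + (ε • p.1, ε ^ 2 * ((1 - c) / c) * p.2 - ε ^ 2 * ((c + 1) / 2))) '' A z

/-- Choices of σ-algebras on the spaces of partial histories `(z₀, …, z_k)`; strategies are
required to be measurable from these to the Borel σ-algebra of the space of points. -/
abbrev HistoryAlgebras (N : ℕ) : Type := ∀ k : ℕ, MeasurableSpace (Fin (k + 1) → Point N)

/-- The Borel σ-algebras on the spaces of partial histories. -/
abbrev borelHistories (N : ℕ) : HistoryAlgebras N := fun _ => inferInstance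

/-- The discrete σ-algebras: every map is measurable. -/
abbrev discreteHistories (N : ℕ) : HistoryAlgebras N := fun _ => ⊤

/-- A strategy (of either player): measurable maps sending a partial history `(z₀, …, z_k)` whose
current state `z_k` lies in the running region `D` to a next state in `M z_k`. (The values at the
other histories are never used before the end of the game.) -/
structure Strategy {N : ℕ} (𝓜 : HistoryAlgebras N) (D : Set (Point N))
    (M : Point N → Set (Point N)) where
  next : ∀ k : ℕ, (Fin (k + 1) → Point N) → Point N
  measurable_next : ∀ k, Measurable[𝓜 k] (next k)
  next_mem : ∀ k (h : Fin (k + 1) → Point N), h (Fin.last k) ∈ D →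
    next k h ∈ M (h (Fin.last k))

section Game

variable {N : ℕ} {𝓜 : HistoryAlgebras N} {D : Set (Point N)} {M : Point N → Set (Point N)}

/-- Infinitely many independent tosses of a fair coin (`true`: Player I wins the toss). -/
noncomputable def coinTosses : Measure (ℕ → Bool) :=
  Measure.infinitePi fun _ => (PMF.uniformOfFintype Bool).toMeasure

/-- The partial history `(z₀, …, z_k)` after `k` rounds, for the coin sequence `ω`. -/
def history (S₁ S₂ : Strategy 𝓜 D M) (z₀ : Point N) (ω : ℕ → Bool) :
    (k : ℕ) → Fin (k + 1) → Point N
  | 0 => fun _ => z₀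
  | k + 1 =>
    Fin.snoc (α := fun _ => Point N) (history S₁ S₂ z₀ ω k)
      (if ω k = true then S₁.next k (history S₁ S₂ z₀ ω k)
        else S₂.next k (history S₁ S₂ z₀ ω k))

/-- The state after `k` rounds. -/
def state (S₁ S₂ : Strategy 𝓜 D M) (z₀ : Point N) (ω : ℕ → Bool) (k : ℕ) : Point N :=
  history S₁ S₂ z₀ ω k (Fin.last k)

/-- The number `τ` of rounds until the token first hits the terminal set `G`. -/
noncomputable def stopTime (G : Set (Point N)) (S₁ S₂ : Strategy 𝓜 D M) (z₀ : Point N)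
    (ω : ℕ → Bool) : ℕ :=
  sInf {k | state S₁ S₂ z₀ ω k ∈ G}

/-- The expected payoff `𝔼[F(x_τ, t_τ)]` for given strategies and starting point. -/
noncomputable def expectedPayoff (G : Set (Point N)) (F : Point N → ℝ)
    (S₁ S₂ : Strategy 𝓜 D M) (z₀ : Point N) : ℝ :=
  ∫ ω, F (state S₁ S₂ z₀ ω (stopTime G S₁ S₂ z₀ ω)) ∂coinTosses

end Game

/-- The value for Player I: `sup_{S_I} inf_{S_II} 𝔼[F(x_τ, t_τ)]`. -/
noncomputable def valueI {N : ℕ} (𝓜 : HistoryAlgebras N) (Ω : Set (EuclideanSpace ℝ (Fin N)))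
    (T c ε : ℝ) (A : Point N → Set (Point N)) (F : Point N → ℝ) (z : Point N) : ℝ :=
  ⨆ S₁ : Strategy 𝓜 (cylinder Ω T) (moves c ε A),
    ⨅ S₂ : Strategy 𝓜 (cylinder Ω T) (moves c ε A),
      expectedPayoff (strip Ω T ε) F S₁ S₂ z

/-- The value for Player II: `inf_{S_II} sup_{S_I} 𝔼[F(x_τ, t_τ)]`. -/
noncomputable def valueII {N : ℕ} (𝓜 : HistoryAlgebras N) (Ω : Set (EuclideanSpace ℝ (Fin N)))
    (T c ε : ℝ) (A : Point N → Set (Point N)) (F : Point N → ℝ) (z : Point N) : ℝ :=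
  ⨅ S₂ : Strategy 𝓜 (cylinder Ω T) (moves c ε A),
    ⨆ S₁ : Strategy 𝓜 (cylinder Ω T) (moves c ε A),
      expectedPayoff (strip Ω T ε) F S₁ S₂ z

/-- `v` is bounded on the set of moves from each point of the cylinder, i.e. the supremum and the
infimum in the dynamic programming principle are real numbers. -/
def BddOnMoves {N : ℕ} (Ω : Set (EuclideanSpace ℝ (Fin N))) (T c ε : ℝ)
    (A : Point N → Set (Point N)) (v : Point N → ℝ) : Prop :=
  ∀ z ∈ cylinder Ω T, BddAbove (v '' moves c ε A z) ∧ BddBelow (v '' moves c ε A z)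

/-- The right-hand side of the dynamic programming principle. -/
noncomputable def midrange {N : ℕ} (c ε : ℝ) (A : Point N → Set (Point N)) (v : Point N → ℝ)
    (z : Point N) : ℝ :=
  1 / 2 * sSup (v '' moves c ε A z) + 1 / 2 * sInf (v '' moves c ε A z)

/-- Subsolutions of the dynamic programming principle. -/
def IsSubsolution {N : ℕ} (Ω : Set (EuclideanSpace ℝ (Fin N))) (T c ε : ℝ)
    (A : Point N → Set (Point N)) (v : Point N → ℝ) : Prop :=
  BddOnMoves Ω T c ε A v ∧ ∀ z ∈ cylinder Ω T, v z ≤ midrange c ε A v z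

/-- Supersolutions of the dynamic programming principle. -/
def IsSupersolution {N : ℕ} (Ω : Set (EuclideanSpace ℝ (Fin N))) (T c ε : ℝ)
    (A : Point N → Set (Point N)) (v : Point N → ℝ) : Prop :=
  BddOnMoves Ω T c ε A v ∧ ∀ z ∈ cylinder Ω T, midrange c ε A v z ≤ v z

/-- `v` satisfies the dynamic programming principle in the cylinder, with boundary values `F` in
the strip of width `ε`. -/
def IsDPPFunction {N : ℕ} (Ω : Set (EuclideanSpace ℝ (Fin N))) (T c ε : ℝ)
    (A : Point N → Set (Point N)) (F v : Point N → ℝ) : Prop :=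
  BddOnMoves Ω T c ε A v ∧ (∀ z ∈ cylinder Ω T, v z = midrange c ε A v z) ∧
    ∀ z ∈ strip Ω T ε, v z = F z

end TugOfWar

/-! Every move lowers the clock by at least `c * ε ^ 2`, so the game ends within a fixed number `n`
of rounds and every quantity up to the end depends on finitely many coins. Integrability is
therefore automatic, with no regularity of `v`, `A` or the strategies. If Player I always moves
within `δ` of the supremum of a subsolution `v`, the value of `v` along the stopped game is a
submartingale up to an error `δ / 2` per round, whence `v z₀ - n * δ ≤ expectedPayoff`
(`le_expectedPayoff_of_nearOptimal`). The near-optimal selection need not be measurable. For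
`valueII`, however, Player II's strategy is fixed first; only finitely many histories are then
reachable, and the selection can be imitated by an admissible strategy
(`exists_strategy_expectedPayoff_eq`). Supersolutions follow by changing signs and exchanging the
players. Without measurability restrictions the selection is itself admissible, so every DPP
function equals both values; value iteration supplies one. -/

namespace TugOfWar

/-! ### Symmetries of the fair coin measure -/

section CoinFlips

/-- Reverse the coins of `ω` at the indices where `b` is `true`. -/
def flipCoins (b ω : ℕ → Bool) : ℕ → Bool := fun i => xor (b i) (ω i)

lemma flipCoins_involutive (b : ℕ → Bool) : Function.Involutive (flipCoins b) := by
  intro ω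
  funext i
  simp [flipCoins]

lemma measurable_flipCoins (b : ℕ → Bool) : Measurable (flipCoins b) :=
  measurable_pi_lambda _ fun i =>
    (Measurable.of_discrete (f := fun x : Bool => xor (b i) x)).comp (measurable_pi_apply i)

instance isProbabilityMeasure_coinTosses : IsProbabilityMeasure coinTosses := by
  unfold coinTosses
  infer_instance

lemma map_xor_fairCoin (a : Bool) :
    ((PMF.uniformOfFintype Bool).toMeasure).map (fun x => xor a x) =
      (PMF.uniformOfFintype Bool).toMeasure := by
  refine Measure.ext_of_singleton fun x => ?_
  have h : (fun x => xor a x) ⁻¹' {x} = {xor a x} := by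
    ext y
    cases a <;> cases x <;> cases y <;> simp
  rw [Measure.map_apply .of_discrete (measurableSet_singleton x), h,
    PMF.toMeasure_apply_singleton _ _ (measurableSet_singleton _),
    PMF.toMeasure_apply_singleton _ _ (measurableSet_singleton _)]
  simp

lemma map_flipCoins (b : ℕ → Bool) : coinTosses.map (flipCoins b) = coinTosses := by
  have h := Measure.infinitePi_map_pi (μ := fun _ : ℕ => (PMF.uniformOfFintype Bool).toMeasure)
    (f := fun i (x : Bool) => xor (b i) x) (fun _ => .of_discrete)
  simp only [map_xor_fairCoin] at h
  exact h

/-- Since the flip is a measurable equivalence preserving the measure, no measurability of `f` is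
needed. -/
lemma integral_flipCoins (b : ℕ → Bool) (f : (ℕ → Bool) → ℝ) :
    ∫ ω, f (flipCoins b ω) ∂coinTosses = ∫ ω, f ω ∂coinTosses := by
  let e := MeasurableEquiv.ofInvolutive _ (flipCoins_involutive b) (measurable_flipCoins b)
  exact MeasurePreserving.integral_comp' (f := e)
    ⟨measurable_flipCoins b, map_flipCoins b⟩ f

/-- Such a function factors through the finite discrete space of the first `k` tosses. -/
lemma integrable_of_dependsOn {f : (ℕ → Bool) → ℝ} {k : ℕ} (hf : DependsOn f (Iio k)) :
    Integrable f coinTosses := by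
  let r : (ℕ → Bool) → Fin k → Bool := fun ω i => ω i
  let g : (Fin k → Bool) → ℝ := fun x => f fun i => if h : i < k then x ⟨i, h⟩ else false
  have hr : Measurable r := by fun_prop
  have hfg : f = g ∘ r := by
    funext ω
    refine hf fun i hi => ?_
    have hi' : i < k := hi
    simp [r, hi']
  rw [hfg]
  have : IsFiniteMeasure (coinTosses.map r) := inferInstance
  exact (Integrable.of_finite (f := g)).comp_measurable hr

/-- The indicator sequence of the `k`-th toss. -/
def onlyToss (k : ℕ) : ℕ → Bool := fun i => decide (i = k)

lemma flipCoins_onlyToss_of_ne {k i : ℕ} (h : i ≠ k) (ω : ℕ → Bool) :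
    flipCoins (onlyToss k) ω i = ω i := by
  simp [flipCoins, onlyToss, h]

lemma flipCoins_onlyToss_self (k : ℕ) (ω : ℕ → Bool) :
    flipCoins (onlyToss k) ω k = !ω k := by
  simp [flipCoins, onlyToss]

/-- A one-step estimate for averages over the `k`-th toss integrates. -/
lemma integral_le_of_flip {f g : (ℕ → Bool) → ℝ} {k : ℕ} {δ : ℝ}
    (hf : DependsOn f (Iio k)) (hg : DependsOn g (Iio (k + 1)))
    (h : ∀ ω, 2 * f ω - δ ≤ g ω + g (flipCoins (onlyToss k) ω)) :
    ∫ ω, f ω ∂coinTosses - δ / 2 ≤ ∫ ω, g ω ∂coinTosses := by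
  have hg' : DependsOn (fun ω => g (flipCoins (onlyToss k) ω)) (Iio (k + 1)) :=
    fun ω ω' hω => hg fun i hi => by simp only [flipCoins, hω i hi]
  have hfi := integrable_of_dependsOn hf
  have hgi := integrable_of_dependsOn hg
  have hgi' := integrable_of_dependsOn hg'
  have key := integral_mono ((hfi.const_mul 2).sub (integrable_const δ)) (hgi.add hgi') h
  simp only [Pi.sub_apply, Pi.add_apply] at key
  rw [integral_add hgi hgi', integral_flipCoins, integral_sub (hfi.const_mul 2)
    (integrable_const δ), integral_const_mul, integral_const] at key
  simp at key
  linarith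

end CoinFlips

/-! ### The abstract terminating game -/

section Game

variable {N : ℕ} {𝓜 : HistoryAlgebras N} {D G : Set (Point N)} {M : Point N → Set (Point N)}

lemma history_congr (S₁ S₂ : Strategy 𝓜 D M) (z₀ : Point N) {ω ω' : ℕ → Bool} {k : ℕ}
    (h : ∀ i < k, ω i = ω' i) : history S₁ S₂ z₀ ω k = history S₁ S₂ z₀ ω' k := by
  induction k with
  | zero => rfl
  | succ k ih =>
    simp only [history, ih fun i hi => h i (by omega), h k (by omega)]

lemma state_zero (S₁ S₂ : Strategy 𝓜 D M) (z₀ : Point N) (ω : ℕ → Bool) :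
    state S₁ S₂ z₀ ω 0 = z₀ := rfl

lemma state_succ (S₁ S₂ : Strategy 𝓜 D M) (z₀ : Point N) (ω : ℕ → Bool) (k : ℕ) :
    state S₁ S₂ z₀ ω (k + 1) =
      if ω k = true then S₁.next k (history S₁ S₂ z₀ ω k)
        else S₂.next k (history S₁ S₂ z₀ ω k) := by
  simp [state, history]

lemma state_succ_mem (S₁ S₂ : Strategy 𝓜 D M) (z₀ : Point N) (ω : ℕ → Bool) {k : ℕ}
    (h : state S₁ S₂ z₀ ω k ∈ D) : state S₁ S₂ z₀ ω (k + 1) ∈ M (state S₁ S₂ z₀ ω k) := by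
  rw [state_succ]
  split_ifs
  · exact S₁.next_mem k _ h
  · exact S₂.next_mem k _ h

lemma history_swap (S₁ S₂ : Strategy 𝓜 D M) (z₀ : Point N) (ω : ℕ → Bool) (k : ℕ) :
    history S₂ S₁ z₀ ω k = history S₁ S₂ z₀ (flipCoins (fun _ => true) ω) k := by
  induction k with
  | zero => rfl
  | succ k ih =>
    have hk : flipCoins (fun _ => true) ω k = !ω k := by simp [flipCoins]
    simp only [history, ih, hk]
    rcases h : ω k <;> simp

/-- The two players have symmetric roles in the expected payoff. -/
lemma expectedPayoff_swap (G : Set (Point N)) (F : Point N → ℝ) (S₁ S₂ : Strategy 𝓜 D M)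
    (z₀ : Point N) : expectedPayoff G F S₂ S₁ z₀ = expectedPayoff G F S₁ S₂ z₀ := by
  have e (ω) : state S₂ S₁ z₀ ω = state S₁ S₂ z₀ (flipCoins (fun _ => true) ω) :=
    funext fun k => by rw [state, state, history_swap S₁ S₂]
  simp only [expectedPayoff, stopTime, e]
  exact integral_flipCoins (fun _ => true)
    fun ω => F (state S₁ S₂ z₀ ω (stopTime G S₁ S₂ z₀ ω))

lemma expectedPayoff_neg (G : Set (Point N)) (F : Point N → ℝ) (S₁ S₂ : Strategy 𝓜 D M)
    (z₀ : Point N) : expectedPayoff G (-F) S₁ S₂ z₀ = -expectedPayoff G F S₁ S₂ z₀ := by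
  simp [expectedPayoff, integral_neg]

/-- The running region `D`, the terminal set `G` and the moves `M` form a game whose clock
lies in `(0, T]` while running and drops by at least `a` in each round. -/
structure IsTerminating (D G : Set (Point N)) (M : Point N → Set (Point N)) (a T : ℝ) :
    Prop where
  drop_pos : 0 < a
  disjoint : Disjoint D G
  moves_nonempty : ∀ z ∈ D, (M z).Nonempty
  moves_subset : ∀ z ∈ D, M z ⊆ D ∪ G
  clock_pos : ∀ z ∈ D, 0 < z.2
  clock_le : ∀ z ∈ D, z.2 ≤ T
  clock_drop : ∀ z ∈ D, ∀ w ∈ M z, w.2 ≤ z.2 - a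

open Classical in
/-- The state after `k` rounds of the game which is frozen once it hits `G`. -/
noncomputable def stoppedState (G : Set (Point N)) (S₁ S₂ : Strategy 𝓜 D M) (z₀ : Point N)
    (ω : ℕ → Bool) : ℕ → Point N
  | 0 => z₀
  | k + 1 => if stoppedState G S₁ S₂ z₀ ω k ∈ G then stoppedState G S₁ S₂ z₀ ω k
      else state S₁ S₂ z₀ ω (k + 1)

lemma stoppedState_congr (S₁ S₂ : Strategy 𝓜 D M) (z₀ : Point N) {ω ω' : ℕ → Bool} {k : ℕ}
    (h : ∀ i < k, ω i = ω' i) :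
    stoppedState G S₁ S₂ z₀ ω k = stoppedState G S₁ S₂ z₀ ω' k := by
  induction k with
  | zero => rfl
  | succ k ih =>
    rw [stoppedState, stoppedState, ih fun i hi => h i (by omega), state, state,
      history_congr S₁ S₂ z₀ h]

lemma dependsOn_stoppedState (v : Point N → ℝ) (S₁ S₂ : Strategy 𝓜 D M) (z₀ : Point N) (k : ℕ) :
    DependsOn (fun ω => v (stoppedState G S₁ S₂ z₀ ω k)) (Iio k) :=
  fun _ _ h => congrArg v (stoppedState_congr S₁ S₂ z₀ h)

variable {a T : ℝ}

/-- Invariant for induction on `k`: avoidance of `G` so far identifies the next entry into `G` as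
the first one, and the clock bound rules out the second alternative once `T ≤ k * a`. -/
lemma stoppedState_spec (hG : IsTerminating D G M a T) (S₁ S₂ : Strategy 𝓜 D M) {z₀ : Point N}
    (hz : z₀ ∈ D ∪ G) (ω : ℕ → Bool) (k : ℕ) :
    (stoppedState G S₁ S₂ z₀ ω k ∈ G ∧
      stoppedState G S₁ S₂ z₀ ω k = state S₁ S₂ z₀ ω (stopTime G S₁ S₂ z₀ ω)) ∨
    (stoppedState G S₁ S₂ z₀ ω k ∈ D ∧ stoppedState G S₁ S₂ z₀ ω k = state S₁ S₂ z₀ ω k ∧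
      (∀ j ≤ k, state S₁ S₂ z₀ ω j ∉ G) ∧ (state S₁ S₂ z₀ ω k).2 ≤ T - k * a) := by
  have first {k : ℕ} (hk : state S₁ S₂ z₀ ω k ∈ G) (hj : ∀ j < k, state S₁ S₂ z₀ ω j ∉ G) :
      stopTime G S₁ S₂ z₀ ω = k :=
    le_antisymm (Nat.sInf_le hk) (le_csInf ⟨k, hk⟩ fun j hj' => not_lt.1 fun hlt => hj j hlt hj')
  induction k with
  | zero =>
    rcases hz with hz | hz
    · have hz' : z₀ ∉ G := fun h => hG.disjoint.le_bot ⟨hz, h⟩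
      refine Or.inr ⟨hz, by rfl, fun j hj => ?_, ?_⟩
      · obtain rfl : j = 0 := by omega
        exact hz'
      · simpa [state_zero] using hG.clock_le _ hz
    · refine Or.inl ⟨hz, ?_⟩
      rw [first (k := 0) hz (by simp)]
      rfl
  | succ k ih =>
    rcases ih with ⟨h₁, h₂⟩ | ⟨h₁, h₂, h₃, h₄⟩
    · rw [stoppedState, if_pos h₁]
      exact Or.inl ⟨h₁, h₂⟩
    · have hn : stoppedState G S₁ S₂ z₀ ω k ∉ G := h₂ ▸ h₃ k le_rfl
      rw [stoppedState, if_neg hn]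
      rw [h₂] at h₁
      have hmem := state_succ_mem S₁ S₂ z₀ ω h₁
      rcases hG.moves_subset _ h₁ hmem with h | h
      · refine Or.inr ⟨h, rfl, fun j hj => ?_, ?_⟩
        · rcases hj.lt_or_eq with hj | rfl
          · exact h₃ j (by omega)
          · exact fun h' => hG.disjoint.le_bot ⟨h, h'⟩
        · have := hG.clock_drop _ h₁ _ hmem
          push_cast
          linarith
      · exact Or.inl ⟨h, by rw [first h fun j hj => h₃ j (by omega)]⟩

lemma stoppedState_eq (hG : IsTerminating D G M a T) (S₁ S₂ : Strategy 𝓜 D M) {z₀ : Point N}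
    (hz : z₀ ∈ D ∪ G) (ω : ℕ → Bool) {n : ℕ} (hn : T ≤ n * a) :
    stoppedState G S₁ S₂ z₀ ω n ∈ G ∧
      state S₁ S₂ z₀ ω (stopTime G S₁ S₂ z₀ ω) = stoppedState G S₁ S₂ z₀ ω n := by
  rcases stoppedState_spec hG S₁ S₂ hz ω n with ⟨h₁, h₂⟩ | ⟨h₁, h₂, h₃, h₄⟩
  · exact ⟨h₁, h₂.symm⟩
  · rw [h₂] at h₁
    have := hG.clock_pos _ h₁
    linarith

lemma IsTerminating.exists_rounds (hG : IsTerminating D G M a T) : ∃ n : ℕ, T ≤ n * a := by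
  obtain ⟨n, hn⟩ := exists_nat_ge (T / a)
  exact ⟨n, (div_le_iff₀ hG.drop_pos).1 hn⟩

/-- Provides the boundedness without which real suprema and infima over strategies would take
default values. -/
lemma abs_expectedPayoff_le (hG : IsTerminating D G M a T) {F : Point N → ℝ} {C : ℝ}
    (hF : ∀ z ∈ G, |F z| ≤ C) (S₁ S₂ : Strategy 𝓜 D M) {z₀ : Point N} (hz : z₀ ∈ D ∪ G) :
    |expectedPayoff G F S₁ S₂ z₀| ≤ C := by
  obtain ⟨n, hn⟩ := hG.exists_rounds
  have h : ∀ ω, ‖F (state S₁ S₂ z₀ ω (stopTime G S₁ S₂ z₀ ω))‖ ≤ C := fun ω => by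
    obtain ⟨h₁, h₂⟩ := stoppedState_eq hG S₁ S₂ hz ω hn
    rw [h₂]
    exact hF _ h₁
  simpa [expectedPayoff] using
    norm_integral_le_of_norm_le_const (μ := coinTosses) (Filter.Eventually.of_forall h)

/-- Averaging over toss `k` gives at least `(sSup - δ) / 2 + sInf / 2`, hence at least the current
value of `v` minus `δ / 2`. Pairing each coin sequence with its flip at `k` replaces conditional
expectation. -/
lemma le_expectedPayoff_of_nearOptimal (hG : IsTerminating D G M a T) {F v : Point N → ℝ}
    (hbdd : ∀ z ∈ D, BddBelow (v '' M z))
    (hsub : ∀ z ∈ D, v z ≤ 1 / 2 * sSup (v '' M z) + 1 / 2 * sInf (v '' M z))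
    (hvF : ∀ z ∈ G, v z ≤ F z) {δ : ℝ} {S₁ : Strategy 𝓜 D M}
    (hS₁ : ∀ k (h : Fin (k + 1) → Point N), h (Fin.last k) ∈ D →
      sSup (v '' M (h (Fin.last k))) - δ ≤ v (S₁.next k h))
    (S₂ : Strategy 𝓜 D M) {z₀ : Point N} (hz : z₀ ∈ D ∪ G) (hδ : 0 ≤ δ) {n : ℕ}
    (hn : T ≤ n * a) :
    v z₀ - n * δ ≤ expectedPayoff G F S₁ S₂ z₀ := by
  have step (k : ℕ) (ω : ℕ → Bool) : 2 * v (stoppedState G S₁ S₂ z₀ ω k) - δ ≤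
      v (stoppedState G S₁ S₂ z₀ ω (k + 1)) +
        v (stoppedState G S₁ S₂ z₀ (flipCoins (onlyToss k) ω) (k + 1)) := by
    have hω : ∀ i < k, flipCoins (onlyToss k) ω i = ω i :=
      fun i hi => flipCoins_onlyToss_of_ne hi.ne ω
    rw [stoppedState, stoppedState, stoppedState_congr S₁ S₂ z₀ hω]
    rcases stoppedState_spec hG S₁ S₂ hz ω k with ⟨h₁, h₂⟩ | ⟨h₁, h₂, h₃, h₄⟩
    · rw [if_pos h₁, if_pos h₁]
      linarith
    · have hn : stoppedState G S₁ S₂ z₀ ω k ∉ G := h₂ ▸ h₃ k le_rfl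
      rw [if_neg hn, if_neg hn]
      -- Both coin sequences share the history up to round `k`; one successor is Player I's choice
      -- and the other Player II's.
      simp only [state_succ, history_congr S₁ S₂ z₀ hω, flipCoins_onlyToss_self]
      rw [h₂] at h₁ ⊢
      have e₁ := hS₁ k (history S₁ S₂ z₀ ω k) h₁
      have e₂ : sInf (v '' M (state S₁ S₂ z₀ ω k)) ≤ v (S₂.next k (history S₁ S₂ z₀ ω k)) :=
        csInf_le (hbdd _ h₁) (mem_image_of_mem v (S₂.next_mem k _ h₁))
      have e₃ := hsub _ h₁
      change sSup (v '' M (state S₁ S₂ z₀ ω k)) - δ ≤ _ at e₁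
      cases ω k <;> simp <;> linarith
  have main (k : ℕ) : v z₀ - k * (δ / 2) ≤
      ∫ ω, v (stoppedState G S₁ S₂ z₀ ω k) ∂coinTosses := by
    induction k with
    | zero => simp [stoppedState]
    | succ k ih =>
      have := integral_le_of_flip (dependsOn_stoppedState v S₁ S₂ z₀ k)
        (dependsOn_stoppedState v S₁ S₂ z₀ (k + 1)) (step k)
      push_cast
      linarith
  have last : ∫ ω, v (stoppedState G S₁ S₂ z₀ ω n) ∂coinTosses ≤
      expectedPayoff G F S₁ S₂ z₀ := by
    have hF (ω) : F (state S₁ S₂ z₀ ω (stopTime G S₁ S₂ z₀ ω)) =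
        F (stoppedState G S₁ S₂ z₀ ω n) := by
      rw [(stoppedState_eq hG S₁ S₂ hz ω hn).2]
    simp only [expectedPayoff, hF]
    exact integral_mono (integrable_of_dependsOn (dependsOn_stoppedState v S₁ S₂ z₀ n))
      (integrable_of_dependsOn (dependsOn_stoppedState F S₁ S₂ z₀ n))
      fun ω => hvF _ (stoppedState_eq hG S₁ S₂ hz ω hn).1
  have := main n
  have : (0 : ℝ) ≤ n * δ := by positivity
  linarith

/-- Against a subsolution below the payoff, Player I has a strategy, without measurability
restriction, that guarantees the subsolution up to any `δ > 0`. -/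
lemma exists_strategy_le_expectedPayoff (hG : IsTerminating D G M a T) {F v : Point N → ℝ}
    (hbdd : ∀ z ∈ D, BddAbove (v '' M z) ∧ BddBelow (v '' M z))
    (hsub : ∀ z ∈ D, v z ≤ 1 / 2 * sSup (v '' M z) + 1 / 2 * sInf (v '' M z))
    (hvF : ∀ z ∈ G, v z ≤ F z) {δ : ℝ} (hδ : 0 < δ) :
    ∃ S₁ : Strategy (discreteHistories N) D M, ∀ S₂ : Strategy (discreteHistories N) D M,
      ∀ z ∈ D ∪ G, v z - δ ≤ expectedPayoff G F S₁ S₂ z := by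
  obtain ⟨n, hn⟩ := hG.exists_rounds
  -- The total loss `n * δ'` stays below `δ`; the `+ 1` covers `n = 0`.
  set δ' : ℝ := δ / (n + 1) with hδ'
  have hδ'0 : 0 < δ' := by positivity
  have hex (z : Point N) : ∃ w, z ∈ D → w ∈ M z ∧ sSup (v '' M z) - δ' ≤ v w := by
    by_cases hz : z ∈ D
    · obtain ⟨_, ⟨w, hw, rfl⟩, h⟩ := exists_lt_of_lt_csSup ((hG.moves_nonempty z hz).image v)
        (sub_lt_self (sSup (v '' M z)) hδ'0)
      exact ⟨w, fun _ => ⟨hw, h.le⟩⟩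
    · exact ⟨z, fun h => absurd h hz⟩
  choose g hg using hex
  let S₁ : Strategy (discreteHistories N) D M :=
    ⟨fun k h => g (h (Fin.last k)), fun _ => measurable_from_top, fun _ _ h => (hg _ h).1⟩
  refine ⟨S₁, fun S₂ z hz => ?_⟩
  have key := le_expectedPayoff_of_nearOptimal hG (fun z hz => (hbdd z hz).2) hsub hvF
    (S₁ := S₁) (fun k h hh => (hg _ hh).2) S₂ hz hδ'0.le hn
  have : (n : ℝ) * δ' ≤ δ := by
    have : ((n : ℝ) + 1) * δ' = δ := by rw [hδ']; field_simp
    linarith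
  linarith

/-! ### Removing the measurability restriction -/

/-- A strategy, seen without its measurability. -/
def Strategy.forget (S : Strategy 𝓜 D M) : Strategy (discreteHistories N) D M :=
  ⟨S.next, fun _ => measurable_from_top, S.next_mem⟩

lemma finite_range_history (S₁ S₂ : Strategy 𝓜 D M) (z₀ : Point N) (k : ℕ) :
    (range fun ω => history S₁ S₂ z₀ ω k).Finite := by
  let f : (Fin k → Bool) → Fin (k + 1) → Point N :=
    fun x => history S₁ S₂ z₀ (fun i => if h : i < k then x ⟨i, h⟩ else false) k
  refine (finite_range f).subset ?_
  rintro _ ⟨ω, rfl⟩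
  exact ⟨fun i => ω i, history_congr _ _ _ fun i hi => by simp [hi]⟩

/-- Only finitely many histories are reachable against a given strategy, so every strategy can be
imitated by an admissible one, if there is any. -/
lemma exists_strategy_expectedPayoff_eq (h𝓜 : ∀ k, borelHistories N k ≤ 𝓜 k)
    (S₀ : Strategy 𝓜 D M) (S₁ : Strategy (discreteHistories N) D M) (S₂ : Strategy 𝓜 D M)
    (z₀ : Point N) :
    ∃ S : Strategy 𝓜 D M, ∀ (G : Set (Point N)) (F : Point N → ℝ),
      expectedPayoff G F S S₂ z₀ = expectedPayoff G F S₁ S₂.forget z₀ := by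
  classical
  let R (k : ℕ) : Set (Fin (k + 1) → Point N) :=
    range fun ω => history S₁ S₂.forget z₀ ω k
  let S : Strategy 𝓜 D M :=
    { next := fun k h => if h ∈ R k then S₁.next k h else S₀.next k h
      measurable_next := fun k => by
        let _ := 𝓜 k
        -- Singletons are Borel, so altering `S₀.next k` on a finite set keeps it measurable.
        have : @MeasurableSingletonClass _ (𝓜 k) :=
          ⟨fun x => h𝓜 k _ (@measurableSet_singleton _ (borelHistories N k) _ x)⟩
        refine (S₀.measurable_next k).measurable_of_countable_ne
          ((finite_range_history S₁ S₂.forget z₀ k).countable.mono fun h hh => ?_)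
        by_contra hR
        exact hh (if_neg hR).symm
      next_mem := fun k h hh => by
        split_ifs
        · exact S₁.next_mem k h hh
        · exact S₀.next_mem k h hh }
  -- Play never leaves `R k`, so the fallback `S₀` is never consulted.
  have hS (ω k) : history S S₂ z₀ ω k = history S₁ S₂.forget z₀ ω k := by
    induction k with
    | zero => rfl
    | succ k ih =>
      have hmem : history S₁ S₂.forget z₀ ω k ∈ R k := ⟨ω, rfl⟩
      simp only [history, ih, S, if_pos hmem]
      rfl
  have e : state S S₂ z₀ = state S₁ S₂.forget z₀ :=
    funext fun ω => funext fun k => by rw [state, state, hS]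
  refine ⟨S, fun G F => ?_⟩
  simp only [expectedPayoff, stopTime, e]

end Game

end TugOfWar

namespace TugOfWar

/-! ### Comparison for the parabolic game -/

section Value

variable {N : ℕ} {𝓜 : HistoryAlgebras N} {Ω : Set (EuclideanSpace ℝ (Fin N))} {T c ε : ℝ}
  {A : Point N → Set (Point N)} {F v : Point N → ℝ}

/-- The distance from `y` to `s` is attained on the frontier and is at most `dist y x`. -/
lemma mem_cthickening_frontier {s : Set (EuclideanSpace ℝ (Fin N))}
    {x y : EuclideanSpace ℝ (Fin N)} (hx : x ∈ s) (hy : y ∉ s) :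
    y ∈ Metric.cthickening (dist y x) (frontier s) := by
  obtain ⟨w, hw, hyw⟩ := exists_mem_frontier_infDist_compl_eq_dist (s := sᶜ) hy
    (fun h => (h ▸ mem_univ x : x ∈ sᶜ) hx)
  rw [frontier_compl] at hw
  rw [compl_compl] at hyw
  exact Metric.mem_cthickening_of_dist_le y w _ _ hw (hyw ▸ Metric.infDist_le_dist_of_mem hx)

/-- For `|s| ≤ c / 2` the clock drop `ε² (c + 1) / 2 - ε² ((1 - c) / c) s` lies between `c ε²` and
`ε²`. The lower bound gives termination; the upper bound keeps landing times above `-ε²`. -/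
lemma isTerminating_moves (hc : 0 < c) (hc1 : c < 1) (hε : 0 < ε)
    (hA : ∀ z ∈ cylinder Ω T, IsShape c (A z)) :
    IsTerminating (cylinder Ω T) (strip Ω T ε) (moves c ε A) (c * ε ^ 2) T where
  drop_pos := by positivity
  disjoint := by
    rw [Set.disjoint_left]
    rintro ⟨x, t⟩ ⟨hx, ht⟩ (⟨-, h⟩ | ⟨h, -⟩)
    · exact absurd h.2 (not_le.2 ht.1)
    · exact h.1 hx
  moves_nonempty := fun z hz => Set.Nonempty.image _ ⟨_, (hA z hz).2.2⟩
  clock_pos := fun z hz => hz.2.1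
  clock_le := fun z hz => hz.2.2
  clock_drop := by
    rintro z hz _ ⟨p, hp, rfl⟩
    have hs := ((hA z hz).2.1 hp).2.2
    have h1 : (1 - c) / c * p.2 ≤ (1 - c) / c * (c / 2) :=
      mul_le_mul_of_nonneg_left hs (div_nonneg (by linarith) hc.le)
    have h2 : (1 - c) / c * (c / 2) = (1 - c) / 2 := by field_simp
    have h3 : ε ^ 2 * ((1 - c) / c * p.2) ≤ ε ^ 2 * ((1 - c) / 2) :=
      mul_le_mul_of_nonneg_left (h1.trans h2.le) (sq_nonneg ε)
    simp only [Prod.snd_add]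
    nlinarith
  moves_subset := by
    rintro z hz _ ⟨p, hp, rfl⟩
    obtain ⟨hy, hs⟩ := (hA z hz).2.1 hp
    have hk : 0 ≤ (1 - c) / c := div_nonneg (by linarith) hc.le
    have h1 : (1 - c) / c * p.2 ≤ (1 - c) / c * (c / 2) := mul_le_mul_of_nonneg_left hs.2 hk
    have h1' : (1 - c) / c * -(c / 2) ≤ (1 - c) / c * p.2 := mul_le_mul_of_nonneg_left hs.1 hk
    have h2 : (1 - c) / c * (c / 2) = (1 - c) / 2 := by field_simp
    have h3 : ε ^ 2 * ((1 - c) / c * p.2) ≤ ε ^ 2 * ((1 - c) / 2) :=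
      mul_le_mul_of_nonneg_left (h1.trans h2.le) (sq_nonneg ε)
    have h4 : ε ^ 2 * (-((1 - c) / 2)) ≤ ε ^ 2 * ((1 - c) / c * p.2) :=
      mul_le_mul_of_nonneg_left (by linarith) (sq_nonneg ε)
    have hε2 : 0 < ε ^ 2 := by positivity
    have hz1 : 0 < z.2 := hz.2.1
    have hz2 : z.2 ≤ T := hz.2.2
    have hdist : dist (z.1 + ε • p.1) z.1 ≤ ε := by
      rw [dist_self_add_left, norm_smul, Real.norm_of_nonneg hε.le]
      have : ‖p.1‖ < 1 := by simpa using hy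
      nlinarith
    by_cases ht : z.2 + (ε ^ 2 * ((1 - c) / c) * p.2 - ε ^ 2 * ((c + 1) / 2)) ≤ 0
    · refine Or.inr (Or.inl ⟨Metric.mem_cthickening_of_dist_le _ z.1 _ _ hz.1 hdist, ?_, ht⟩)
      simp only [Prod.snd_add]
      nlinarith
    · have htT : z.2 + (ε ^ 2 * ((1 - c) / c) * p.2 - ε ^ 2 * ((c + 1) / 2)) ∈ Ioc 0 T :=
        ⟨not_le.1 ht, by nlinarith⟩
      by_cases hx : z.1 + ε • p.1 ∈ Ω
      · exact Or.inl ⟨hx, htT⟩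
      · exact Or.inr (Or.inr ⟨⟨hx, Metric.cthickening_mono hdist _
          (mem_cthickening_frontier hz.1 hx)⟩, htT⟩)

lemma strip_mono {r s : ℝ} (hr : 0 ≤ r) (hrs : r ≤ s) : strip Ω T r ⊆ strip Ω T s := by
  refine union_subset_union ?_ ?_
  · exact prod_mono (Metric.cthickening_mono hrs _)
      (Ioc_subset_Ioc_left (neg_le_neg (pow_le_pow_left₀ hr hrs 2)))
  · exact prod_mono (inter_subset_inter_right _ (Metric.cthickening_mono hrs _)) Subset.rfl

/-- The strategy of always choosing the centre of the shape. -/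
lemma nonempty_strategy (h𝓜 : ∀ k, borelHistories N k ≤ 𝓜 k)
    (hA : ∀ z ∈ cylinder Ω T, IsShape c (A z)) :
    Nonempty (Strategy 𝓜 (cylinder Ω T) (moves c ε A)) := by
  refine ⟨⟨fun k h => h (Fin.last k) + (0, -(ε ^ 2 * ((c + 1) / 2))), fun k => ?_,
    fun k h hh => ⟨_, (hA _ hh).2.2, by simp⟩⟩⟩
  have : Measurable[borelHistories N k] fun h : Fin (k + 1) → Point N =>
      h (Fin.last k) + (0, -(ε ^ 2 * ((c + 1) / 2))) := by
    unfold borelHistories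
    fun_prop
  exact this.mono (h𝓜 k) le_rfl

/-- A sign change exchanges suprema and infima, and reversing all coins exchanges the players. The
sign rules for real `⨆` and `⨅` need no boundedness. -/
lemma valueII_neg (z : Point N) :
    valueII 𝓜 Ω T c ε A (-F) z = -valueI 𝓜 Ω T c ε A F z := by
  have hSup {ι : Type} (f : ι → ℝ) : ⨆ i, -f i = -⨅ i, f i := by
    rw [iSup, iInf, ← Real.sSup_neg, ← image_neg_eq_neg, ← range_comp]
    rfl
  have hInf {ι : Type} (f : ι → ℝ) : ⨅ i, -f i = -⨆ i, f i := by
    rw [iSup, iInf, ← Real.sInf_neg, ← image_neg_eq_neg, ← range_comp]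
    rfl
  simp only [valueI, valueII, expectedPayoff_neg, hSup, hInf]
  congr! 5 with S₁ S₂
  exact expectedPayoff_swap _ _ _ _ _

lemma bddOnMoves_neg (h : BddOnMoves Ω T c ε A v) : BddOnMoves Ω T c ε A (-v) := by
  intro z hz
  have e : (-v) '' moves c ε A z = -(v '' moves c ε A z) := by
    rw [← image_neg_eq_neg, ← image_comp]
    rfl
  rw [e, bddAbove_neg, bddBelow_neg]
  exact (h z hz).symm

lemma midrange_neg (z : Point N) : midrange c ε A (-v) z = -midrange c ε A v z := by
  have e : (-v) '' moves c ε A z = -(v '' moves c ε A z) := by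
    rw [← image_neg_eq_neg, ← image_comp]
    rfl
  rw [midrange, midrange, e, Real.sSup_neg, Real.sInf_neg]
  ring

lemma IsSupersolution.neg (h : IsSupersolution Ω T c ε A v) : IsSubsolution Ω T c ε A (-v) :=
  ⟨bddOnMoves_neg h.1, fun z hz => by
    rw [midrange_neg]
    exact neg_le_neg (h.2 z hz)⟩

lemma IsDPPFunction.isSubsolution (h : IsDPPFunction Ω T c ε A F v) :
    IsSubsolution Ω T c ε A v := ⟨h.1, fun z hz => (h.2.1 z hz).le⟩

lemma IsDPPFunction.isSupersolution (h : IsDPPFunction Ω T c ε A F v) :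
    IsSupersolution Ω T c ε A v := ⟨h.1, fun z hz => (h.2.1 z hz).ge⟩

lemma IsDPPFunction.neg (h : IsDPPFunction Ω T c ε A F v) :
    IsDPPFunction Ω T c ε A (-F) (-v) :=
  ⟨bddOnMoves_neg h.1, fun z hz => by rw [midrange_neg, Pi.neg_apply, h.2.1 z hz],
    fun z hz => by simp [h.2.2 z hz]⟩

variable {a C : ℝ}

/-- Player I's reply may depend on `S₂` and on `z`, which is what allows the imitation of a
non-measurable near-optimal strategy. -/
lemma IsSubsolution.le_valueII
    (hG : IsTerminating (cylinder Ω T) (strip Ω T ε) (moves c ε A) a T)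
    (hF : ∀ z ∈ strip Ω T ε, |F z| ≤ C) (h𝓜 : ∀ k, borelHistories N k ≤ 𝓜 k)
    [Nonempty (Strategy 𝓜 (cylinder Ω T) (moves c ε A))]
    (hv : IsSubsolution Ω T c ε A v) (hvF : ∀ z ∈ strip Ω T ε, v z ≤ F z)
    {z : Point N} (hz : z ∈ cylinder Ω T ∪ strip Ω T ε) :
    v z ≤ valueII 𝓜 Ω T c ε A F z := by
  refine le_ciInf fun S₂ => le_of_forall_pos_sub_le fun δ hδ => ?_
  obtain ⟨S₁, hS₁⟩ := exists_strategy_le_expectedPayoff hG hv.1 hv.2 hvF hδ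
  obtain ⟨S, hS⟩ := exists_strategy_expectedPayoff_eq h𝓜 (Classical.arbitrary _) S₁ S₂ z
  refine (hS₁ S₂.forget z hz).trans ((hS _ F).ge.trans ?_)
  refine le_ciSup (f := fun S₁ => expectedPayoff (strip Ω T ε) F S₁ S₂ z) ⟨C, ?_⟩ S
  rintro _ ⟨S', rfl⟩
  exact (abs_le.1 (abs_expectedPayoff_le hG hF S' S₂ hz)).2

lemma IsSupersolution.valueI_le
    (hG : IsTerminating (cylinder Ω T) (strip Ω T ε) (moves c ε A) a T)
    (hF : ∀ z ∈ strip Ω T ε, |F z| ≤ C) (h𝓜 : ∀ k, borelHistories N k ≤ 𝓜 k)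
    [Nonempty (Strategy 𝓜 (cylinder Ω T) (moves c ε A))]
    (hv : IsSupersolution Ω T c ε A v) (hvF : ∀ z ∈ strip Ω T ε, F z ≤ v z)
    {z : Point N} (hz : z ∈ cylinder Ω T ∪ strip Ω T ε) :
    valueI 𝓜 Ω T c ε A F z ≤ v z := by
  have := IsSubsolution.le_valueII (F := -F) hG (fun z hz => by simpa using hF z hz) h𝓜 hv.neg
    (fun z hz => neg_le_neg (hvF z hz)) hz
  rw [valueII_neg] at this
  exact neg_le_neg_iff.1 this

/-- The near-optimal strategy is now admissible and does not depend on `S₂`, so the bound survives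
the infimum inside. -/
lemma IsSubsolution.le_valueI_discreteHistories
    (hG : IsTerminating (cylinder Ω T) (strip Ω T ε) (moves c ε A) a T)
    (hF : ∀ z ∈ strip Ω T ε, |F z| ≤ C)
    (hv : IsSubsolution Ω T c ε A v) (hvF : ∀ z ∈ strip Ω T ε, v z ≤ F z)
    {z : Point N} (hz : z ∈ cylinder Ω T ∪ strip Ω T ε) :
    v z ≤ valueI (discreteHistories N) Ω T c ε A F z := by
  refine le_of_forall_pos_sub_le fun δ hδ => ?_
  obtain ⟨S₁, hS₁⟩ := exists_strategy_le_expectedPayoff hG hv.1 hv.2 hvF hδ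
  have : Nonempty (Strategy (discreteHistories N) (cylinder Ω T) (moves c ε A)) := ⟨S₁⟩
  refine (le_ciInf fun S₂ => hS₁ S₂ z hz).trans (le_ciSup (f := fun S₁ =>
    ⨅ S₂, expectedPayoff (strip Ω T ε) F S₁ S₂ z) ⟨C, ?_⟩ S₁)
  rintro _ ⟨S', rfl⟩
  refine ciInf_le_of_le ⟨-C, ?_⟩ S₁ (abs_le.1 (abs_expectedPayoff_le hG hF S' S₁ hz)).2
  rintro _ ⟨S₂, rfl⟩
  exact (abs_le.1 (abs_expectedPayoff_le hG hF S' S₂ hz)).1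

/-! ### Existence and uniqueness of the DPP function -/

open scoped Classical in
/-- Value iteration for the dynamic programming principle, started from `F` in the strip. -/
noncomputable def valueIteration (Ω : Set (EuclideanSpace ℝ (Fin N))) (T c ε : ℝ)
    (A : Point N → Set (Point N)) (F : Point N → ℝ) : ℕ → Point N → ℝ
  | 0 => (strip Ω T ε).indicator F
  | n + 1 => (cylinder Ω T).piecewise (midrange c ε A (valueIteration Ω T c ε A F n))
      ((strip Ω T ε).indicator F)

lemma midrange_congr {w : Point N → ℝ} {z : Point N} (h : EqOn v w (moves c ε A z)) :
    midrange c ε A v z = midrange c ε A w z := by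
  rw [midrange, midrange, image_congr h]

open scoped Classical in
lemma abs_valueIteration_le
    (hG : IsTerminating (cylinder Ω T) (strip Ω T ε) (moves c ε A) a T)
    (hF : ∀ z ∈ strip Ω T ε, |F z| ≤ C) (hC : 0 ≤ C) (n : ℕ) (z : Point N) :
    |valueIteration Ω T c ε A F n z| ≤ C := by
  have h0 (z : Point N) : |(strip Ω T ε).indicator F z| ≤ C := by
    by_cases hz : z ∈ strip Ω T ε
    · simpa [hz] using hF z hz
    · simpa [hz] using hC
  induction n generalizing z with
  | zero => exact h0 z
  | succ n ih =>
    by_cases hz : z ∈ cylinder Ω T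
    · simp only [valueIteration, piecewise_eq_of_mem _ _ _ hz, midrange]
      set s := valueIteration Ω T c ε A F n '' moves c ε A z
      have hs : s.Nonempty := (hG.moves_nonempty z hz).image _
      have hsC : ∀ x ∈ s, -C ≤ x ∧ x ≤ C := by
        rintro _ ⟨w, -, rfl⟩
        exact abs_le.1 (ih w)
      have h1 : sSup s ≤ C := csSup_le hs fun x hx => (hsC x hx).2
      have h2 : -C ≤ sInf s := le_csInf hs fun x hx => (hsC x hx).1
      have h3 : sInf s ≤ sSup s :=
        csInf_le_csSup hs ⟨-C, fun x hx => (hsC x hx).1⟩ ⟨C, fun x hx => (hsC x hx).2⟩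
      rw [abs_le]
      constructor <;> linarith
    · simpa only [valueIteration, piecewise_eq_of_notMem _ _ _ hz] using h0 z

open scoped Classical in
-- A move lowers the clock by `a`, so points with clock at most `(n + 1) * a` only see values
-- already stable at stage `n`. At clock at most `0` the point is outside the cylinder.
lemma valueIteration_succ_eq
    (hG : IsTerminating (cylinder Ω T) (strip Ω T ε) (moves c ε A) a T) (n : ℕ) {z : Point N}
    (hz : z.2 ≤ n * a) :
    valueIteration Ω T c ε A F (n + 1) z = valueIteration Ω T c ε A F n z := by
  induction n generalizing z with
  | zero =>
    have hz' : z ∉ cylinder Ω T := fun h => by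
      have := hG.clock_pos z h
      simp at hz
      linarith
    simp only [valueIteration, piecewise_eq_of_notMem _ _ _ hz']
  | succ n ih =>
    rw [valueIteration, valueIteration]
    by_cases h : z ∈ cylinder Ω T
    · rw [piecewise_eq_of_mem _ _ _ h, piecewise_eq_of_mem _ _ _ h]
      refine midrange_congr fun w hw => ih ?_
      have := hG.clock_drop z h w hw
      push_cast at hz
      linarith
    · rw [piecewise_eq_of_notMem _ _ _ h, piecewise_eq_of_notMem _ _ _ h]

open scoped Classical in
lemma exists_isDPPFunction
    (hG : IsTerminating (cylinder Ω T) (strip Ω T ε) (moves c ε A) a T)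
    (hF : ∀ z ∈ strip Ω T ε, |F z| ≤ C) (hC : 0 ≤ C) :
    ∃ v, IsDPPFunction Ω T c ε A F v := by
  obtain ⟨n, hn⟩ := hG.exists_rounds
  have hb := abs_valueIteration_le hG hF hC n
  refine ⟨valueIteration Ω T c ε A F n, fun z _ => ⟨⟨C, ?_⟩, ⟨-C, ?_⟩⟩, fun z hz => ?_,
    fun z hz => ?_⟩
  · rintro _ ⟨w, -, rfl⟩
    exact (abs_le.1 (hb w)).2
  · rintro _ ⟨w, -, rfl⟩
    exact (abs_le.1 (hb w)).1
  · rw [← valueIteration_succ_eq hG n ((hG.clock_le z hz).trans hn), valueIteration,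
      piecewise_eq_of_mem _ _ _ hz]
  · have hz' : z ∉ cylinder Ω T := fun h => hG.disjoint.le_bot ⟨h, hz⟩
    cases n with
    | zero => simp [valueIteration, hz]
    | succ n => simp [valueIteration, hz, hz']

/-- Moves stay in the cylinder and the strip, so values elsewhere play no role. -/
lemma IsDPPFunction.congr {w : Point N → ℝ}
    (hG : IsTerminating (cylinder Ω T) (strip Ω T ε) (moves c ε A) a T)
    (hv : IsDPPFunction Ω T c ε A F v) (h : EqOn w v (cylinder Ω T ∪ strip Ω T ε)) :
    IsDPPFunction Ω T c ε A F w := by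
  refine ⟨fun z hz => ?_, fun z hz => ?_, fun z hz => (h (Or.inr hz)).trans (hv.2.2 z hz)⟩
  · rw [image_congr (h.mono (hG.moves_subset z hz))]
    exact hv.1 z hz
  · rw [midrange_congr (h.mono (hG.moves_subset z hz)), h (Or.inl hz), hv.2.1 z hz]

lemma IsDPPFunction.valueI_discreteHistories_eq
    (hG : IsTerminating (cylinder Ω T) (strip Ω T ε) (moves c ε A) a T)
    (hF : ∀ z ∈ strip Ω T ε, |F z| ≤ C)
    [Nonempty (Strategy (discreteHistories N) (cylinder Ω T) (moves c ε A))]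
    (hv : IsDPPFunction Ω T c ε A F v) :
    EqOn (valueI (discreteHistories N) Ω T c ε A F) v (cylinder Ω T ∪ strip Ω T ε) :=
  fun _ hz => le_antisymm
    (hv.isSupersolution.valueI_le hG hF (fun _ => le_top) (fun z hz => (hv.2.2 z hz).ge) hz)
    (hv.isSubsolution.le_valueI_discreteHistories hG hF (fun z hz => (hv.2.2 z hz).le) hz)

lemma IsDPPFunction.valueII_discreteHistories_eq
    (hG : IsTerminating (cylinder Ω T) (strip Ω T ε) (moves c ε A) a T)
    (hF : ∀ z ∈ strip Ω T ε, |F z| ≤ C)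
    [Nonempty (Strategy (discreteHistories N) (cylinder Ω T) (moves c ε A))]
    (hv : IsDPPFunction Ω T c ε A F v) :
    EqOn (valueII (discreteHistories N) Ω T c ε A F) v (cylinder Ω T ∪ strip Ω T ε) := by
  intro z hz
  have h := hv.neg.valueI_discreteHistories_eq hG (fun z hz => by simpa using hF z hz) hz
  have h' := valueII_neg (𝓜 := discreteHistories N) (Ω := Ω) (T := T) (c := c) (ε := ε) (A := A)
    (F := -F) z
  rw [neg_neg, h] at h'
  simpa using h'

end Value

end TugOfWar

theorem mainTheorem6 {N : ℕ} (Ω : Set (EuclideanSpace ℝ (Fin N)))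
    (hΩ : IsOpen Ω) (hΩb : Bornology.IsBounded Ω)
    (T c ε η : ℝ) (hT : 0 < T) (hc : 0 < c) (hc1 : c < 1) (hε : 0 < ε) (hεη : ε ≤ η)
    (A : TugOfWar.Point N → Set (TugOfWar.Point N))
    (hA : ∀ z ∈ TugOfWar.cylinder Ω T, TugOfWar.IsShape c (A z))
    (F : TugOfWar.Point N → ℝ)
    (hFm : Measurable ((TugOfWar.strip Ω T η).domRestrict F))
    (hFb : ∃ C : ℝ, ∀ z ∈ TugOfWar.strip Ω T η, |F z| ≤ C) :
    (∀ 𝓜 : TugOfWar.HistoryAlgebras N, (∀ k, TugOfWar.borelHistories N k ≤ 𝓜 k) →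
      (∀ v : TugOfWar.Point N → ℝ, TugOfWar.IsSubsolution Ω T c ε A v →
        (∀ z ∈ TugOfWar.strip Ω T ε, v z ≤ F z) →
        ∀ z ∈ TugOfWar.cylinder Ω T, v z ≤ TugOfWar.valueII 𝓜 Ω T c ε A F z) ∧
      (∀ v : TugOfWar.Point N → ℝ, TugOfWar.IsSupersolution Ω T c ε A v →
        (∀ z ∈ TugOfWar.strip Ω T ε, F z ≤ v z) →
        ∀ z ∈ TugOfWar.cylinder Ω T, TugOfWar.valueI 𝓜 Ω T c ε A F z ≤ v z) ∧
      (∀ v : TugOfWar.Point N → ℝ, TugOfWar.IsDPPFunction Ω T c ε A F v →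
        ∀ z ∈ TugOfWar.cylinder Ω T ∪ TugOfWar.strip Ω T ε,
          TugOfWar.valueI 𝓜 Ω T c ε A F z ≤ v z ∧
          v z ≤ TugOfWar.valueII 𝓜 Ω T c ε A F z)) ∧
    TugOfWar.IsDPPFunction Ω T c ε A F
      (TugOfWar.valueI (TugOfWar.discreteHistories N) Ω T c ε A F) ∧
    TugOfWar.IsDPPFunction Ω T c ε A F
      (TugOfWar.valueII (TugOfWar.discreteHistories N) Ω T c ε A F) := by
  have hG := TugOfWar.isTerminating_moves hc hc1 hε hA
  obtain ⟨C₀, hC₀⟩ := hFb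
  -- The bound must be nonnegative because value iteration is extended by `0`.
  have hF : ∀ z ∈ TugOfWar.strip Ω T ε, |F z| ≤ max C₀ 0 := fun z hz =>
    (hC₀ z (TugOfWar.strip_mono hε.le hεη hz)).trans (le_max_left _ _)
  refine ⟨fun 𝓜 h𝓜 => ?_, ?_⟩
  · have := TugOfWar.nonempty_strategy (ε := ε) h𝓜 hA
    refine ⟨fun v hv hvF z hz => hv.le_valueII hG hF h𝓜 hvF (Or.inl hz),
      fun v hv hvF z hz => hv.valueI_le hG hF h𝓜 hvF (Or.inl hz), fun v hv z hz => ⟨?_, ?_⟩⟩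
    · exact hv.isSupersolution.valueI_le hG hF h𝓜 (fun z hz => (hv.2.2 z hz).ge) hz
    · exact hv.isSubsolution.le_valueII hG hF h𝓜 (fun z hz => (hv.2.2 z hz).le) hz
  · have := TugOfWar.nonempty_strategy (𝓜 := TugOfWar.discreteHistories N) (ε := ε)
      (fun _ => le_top) hA
    obtain ⟨v, hv⟩ := TugOfWar.exists_isDPPFunction hG hF (le_max_right _ _)
    exact ⟨hv.congr hG (hv.valueI_discreteHistories_eq hG hF),
      hv.congr hG (hv.valueII_discreteHistories_eq hG hF)⟩
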